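/- Let $\mathcal A=\{1,2,3\}$. For $i,j\in\mathcal A$ with $i\neq j$, let $\beta_{ij}$ be the substitution (endomorphism of the free monoid $\mathcal A^*$) with $\beta_{ij}(j)=ij$ and $\beta_{ij}(k)=k$ for $k\in\mathcal A\setminus\{j\}$, extended to infinite words by concatenation. A Brun word over $3$ letters with directive sequence $(\beta_{i_nj_n})_{n\in\mathbb N}$ is an infinite word $\omega\in\mathcal A^{\mathbb N}$ for which there are infinite words $\omega^{(n)}\in\mathcal A^{\mathbb N}$ with $\omega^{(0)}=\omega$ and $\omega^{(n)}=\beta_{i_nj_n}(\omega^{(n+1)})$ for all $n\in\mathbb N$, where for every $n$ we have $i_n\ne j_n$ and either $(i_{n+1},j_{n+1})=(i_n,j_n)$ or $i_{n+1}=j_n$, and where for each $i\in\mathcal A$ there is $j\in\mathcal A$ such that $(i_n,j_n)=(i,j)$ for infinitely many $n$. An infinite word is $C$-balanced if for any two of its factors $u,v$ of the same length and each letter $a\in\mathcal A$ the numbers of occurrences of $a$ in $u$ and in $v$ differ by at most $C$. Theorem. Let $h\in\mathbb N$. There is a constant $C(h)$ such that each Brun word over $3$ letters with directive sequence $(\beta_{i_nj_n})_{n\in\mathbb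 N}$ satisfying $\{i_n,i_{n+1},\ldots,i_{n+h-1}\}=\{1,2,3\}$ for all $n\in\mathbb N$ is $C(h)$-balanced. -/

import Mathlib

namespace BrunWords

variable {A : Type*}

/-- The finite word `ω_k ω_{k+1} ⋯ ω_{l-1}` (empty if `l ≤ k`). -/
def factor (ω : ℕ → A) (k l : ℕ) : List A := (List.range' k (l - k)).map ω

/-- `u` is a factor of the infinite word `ω`. -/
def IsFactor (ω : ℕ → A) (u : List A) : Prop := ∃ k l : ℕ, k ≤ l ∧ u = factor ω k l

/-- A pair of finite words is `C`-balanced if, for each letter, the numbers of its occurrences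
in the two words differ by at most `C`. -/
def PairBalanced [DecidableEq A] (C : ℕ) (u v : List A) : Prop :=
  ∀ a : A, -(C : ℤ) ≤ (u.count a : ℤ) - (v.count a : ℤ) ∧
    (u.count a : ℤ) - (v.count a : ℤ) ≤ (C : ℤ)

/-- An infinite word is `C`-balanced if each pair of its factors of equal length is. -/
def Balanced [DecidableEq A] (C : ℕ) (ω : ℕ → A) : Prop :=
  ∀ u v : List A, IsFactor ω u → IsFactor ω v → u.length = v.length → PairBalanced C u v

/-- A substitution over `A`, that is, an endomorphism of the free monoid of finite words,
given by the images of the letters. -/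
abbrev Substitution (A : Type*) : Type _ := A → List A

/-- The image of a finite word under a substitution. -/
def Substitution.apply (σ : Substitution A) (w : List A) : List A := w.flatMap σ

/-- `σ(w) = u` for infinite words `w` and `u`: the images of the prefixes of `w` are
arbitrarily long prefixes of `u`. -/
def Substitution.MapsTo (σ : Substitution A) (w u : ℕ → A) : Prop :=
  (∀ n : ℕ, σ.apply (factor w 0 n) = factor u 0 (σ.apply (factor w 0 n)).length) ∧
    ∀ m : ℕ, ∃ n : ℕ, m ≤ (σ.apply (factor w 0 n)).length

/-- `ω` is a limit word of the sequence of substitutions `σ`. -/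
def IsLimitWord (σ : ℕ → Substitution A) (ω : ℕ → A) : Prop :=
  ∃ W : ℕ → ℕ → A, W 0 = ω ∧ ∀ n : ℕ, (σ n).MapsTo (W (n + 1)) (W n)

/-- The Brun substitution `β_{ij}`, mapping `j` to `ij` and fixing every other letter. -/
def brun [DecidableEq A] (i j : A) : Substitution A := fun k => if k = j then [i, j] else [k]

/-- The condition on the indices `(i_n, j_n)` for the sequence `β_{i_n j_n}` to be the
directive sequence of a Brun word. -/
structure IsBrunSequence (i j : ℕ → A) : Prop where
  /-- Each `β_{i_n j_n}` is a Brun substitution. -/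
  ne : ∀ n : ℕ, i n ≠ j n
  /-- Two successive substitutions are `β_{ab} β_{ab}` or `β_{ab} β_{bc}`. -/
  admissible : ∀ n : ℕ, (i (n + 1) = i n ∧ j (n + 1) = j n) ∨ i (n + 1) = j n
  /-- For each letter `a` some `β_{ab}` occurs infinitely often. -/
  infinite : ∀ a : A, ∃ b : A, {n : ℕ | i n = a ∧ j n = b}.Infinite

/-- `ω` is a Brun word with directive sequence `β_{i_n j_n}`. -/
def IsBrunWord [DecidableEq A] (i j : ℕ → A) (ω : ℕ → A) : Prop :=
  IsBrunSequence i j ∧ IsLimitWord (fun n => brun (i n) (j n)) ω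

end BrunWords

/-! The argument measures discrepancy with a linear weight `x` on letters, orthogonal to a stand-in
`f` for the frequency vector. Desubstituting a prefix replaces `x` by its image under the transposed
incidence matrix and `f` by its image under the inverse matrix, so orthogonality persists; each step
loses at most one letter.

While `f` follows the Brun order, the sup norm of `x` on the orthogonal complement of `f` never
grows (`abs_dualStep_le`). The window condition forces strict decrease over `3 * h + 2` steps
(`abs_dualIter_lt_one`), and compactness together with finiteness of the index patterns makes the
ratio uniform (`exists_contraction`). The losses then sum to a geometric series, independent of the
prefix length. No frequency vector of the infinite word is needed: for given factors, an `f` ordered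
for finitely many steps is enough. -/

namespace BrunWords

/-! ### Linear dynamics of Brun's algorithm and its dual. -/

section Dynamics

variable {A : Type*} [DecidableEq A]

/-- The transpose of the incidence matrix of `β_{ij}`. -/
def dualStep (i j : A) (x : A → ℝ) : A → ℝ := fun a => if a = j then x i + x j else x a

/-- The inverse of the incidence matrix of `β_{ij}`. -/
def freqStep (i j : A) (f : A → ℝ) : A → ℝ := fun a => if a = i then f i - f j else f a

/-- Iterated application of the transposed incidence matrices. -/
def dualIter (i j : ℕ → A) (x : A → ℝ) : ℕ → A → ℝ
  | 0 => x
  | n + 1 => dualStep (i n) (j n) (dualIter i j x n)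

/-- Iterated application of the inverse incidence matrices. -/
def freqIter (i j : ℕ → A) (f : A → ℝ) : ℕ → A → ℝ
  | 0 => f
  | n + 1 => freqStep (i n) (j n) (freqIter i j f n)

/-- `i` carries the largest entry of `f`, and `j` the second largest. -/
structure BrunOrdered (i j : A) (f : A → ℝ) : Prop where
  nonneg : ∀ a, 0 ≤ f a
  snd_le_fst : f j ≤ f i
  le_snd : ∀ a, a ≠ i → f a ≤ f j

theorem BrunOrdered.le_fst {i j : A} {f : A → ℝ} (hf : BrunOrdered i j f) (a : A) :
    f a ≤ f i := by
  by_cases h : a = i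
  · rw [h]
  · exact (hf.le_snd a h).trans hf.snd_le_fst

theorem BrunOrdered.fst_pos {i j : A} {f : A → ℝ} (hf : BrunOrdered i j f) (h0 : f ≠ 0) :
    0 < f i := by
  refine lt_of_le_of_ne (hf.nonneg i) fun h => h0 ?_
  funext a
  exact le_antisymm ((hf.le_fst a).trans h.ge) (hf.nonneg a)

theorem freqStep_ne_zero {i j : A} (hij : i ≠ j) {f : A → ℝ} (h0 : f ≠ 0) :
    freqStep i j f ≠ 0 := by
  intro h
  have key : ∀ a, a ≠ i → f a = 0 := fun a ha => by
    simpa [freqStep, ha] using congrFun h a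
  have hi : f i - f j = 0 := by simpa [freqStep] using congrFun h i
  apply h0
  funext a
  by_cases ha : a = i
  · rw [ha]
    have := key j hij.symm
    simp only [Pi.zero_apply]
    linarith
  · exact key a ha

theorem freqIter_ne_zero {i j : ℕ → A} (hij : ∀ n, i n ≠ j n) {f : A → ℝ} (h0 : f ≠ 0) (n : ℕ) :
    freqIter i j f n ≠ 0 := by
  induction n with
  | zero => exact h0
  | succ n ih => exact freqStep_ne_zero (hij n) ih

theorem dualIter_add (i j : ℕ → A) (x : A → ℝ) (m n : ℕ) :
    dualIter i j x (m + n) =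
      dualIter (fun t => i (m + t)) (fun t => j (m + t)) (dualIter i j x m) n := by
  induction n with
  | zero => rfl
  | succ n ih =>
    rw [← Nat.add_assoc]
    simp only [dualIter, ih]

theorem freqIter_add (i j : ℕ → A) (f : A → ℝ) (m n : ℕ) :
    freqIter i j f (m + n) =
      freqIter (fun t => i (m + t)) (fun t => j (m + t)) (freqIter i j f m) n := by
  induction n with
  | zero => rfl
  | succ n ih =>
    rw [← Nat.add_assoc]
    simp only [freqIter, ih]

theorem dualIter_congr {i j i' j' : ℕ → A} (x : A → ℝ) {n : ℕ} (hi : ∀ t < n, i t = i' t)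
    (hj : ∀ t < n, j t = j' t) : dualIter i j x n = dualIter i' j' x n := by
  induction n with
  | zero => rfl
  | succ n ih =>
    simp only [dualIter]
    rw [ih (fun t ht => hi t (by omega)) (fun t ht => hj t (by omega)), hi n (by omega),
      hj n (by omega)]

theorem freqIter_congr {i j i' j' : ℕ → A} (f : A → ℝ) {n : ℕ} (hi : ∀ t < n, i t = i' t)
    (hj : ∀ t < n, j t = j' t) : freqIter i j f n = freqIter i' j' f n := by
  induction n with
  | zero => rfl
  | succ n ih =>
    simp only [freqIter]
    rw [ih (fun t ht => hi t (by omega)) (fun t ht => hj t (by omega)), hi n (by omega),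
      hj n (by omega)]

theorem dualIter_smul (i j : ℕ → A) (c : ℝ) (x : A → ℝ) (n : ℕ) :
    dualIter i j (c • x) n = c • dualIter i j x n := by
  induction n with
  | zero => rfl
  | succ n ih =>
    simp only [dualIter, ih]
    funext a
    by_cases h : a = j n <;> simp [dualStep, h, mul_add]

theorem freqIter_smul (i j : ℕ → A) (c : ℝ) (f : A → ℝ) (n : ℕ) :
    freqIter i j (c • f) n = c • freqIter i j f n := by
  induction n with
  | zero => rfl
  | succ n ih =>
    simp only [freqIter, ih]
    funext a
    by_cases h : a = i n <;> simp [freqStep, h, mul_sub]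

omit [DecidableEq A] in
theorem BrunOrdered.smul {i j : A} {f : A → ℝ} (hf : BrunOrdered i j f) {c : ℝ} (hc : 0 ≤ c) :
    BrunOrdered i j (c • f) where
  nonneg a := mul_nonneg hc (hf.nonneg a)
  snd_le_fst := mul_le_mul_of_nonneg_left hf.snd_le_fst hc
  le_snd a ha := mul_le_mul_of_nonneg_left (hf.le_snd a ha) hc

theorem continuous_dualIter (i j : ℕ → A) (n : ℕ) :
    Continuous fun x : A → ℝ => dualIter i j x n := by
  induction n with
  | zero => exact continuous_id
  | succ n ih =>
    refine continuous_pi fun a => ?_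
    have h := fun b => (continuous_apply b).comp ih
    by_cases ha : a = j n
    · simpa [dualIter, dualStep, ha, Function.comp_def] using! (h (i n)).add (h (j n))
    · simpa [dualIter, dualStep, ha, Function.comp_def] using h a

theorem continuous_freqIter (i j : ℕ → A) (n : ℕ) :
    Continuous fun f : A → ℝ => freqIter i j f n := by
  induction n with
  | zero => exact continuous_id
  | succ n ih =>
    refine continuous_pi fun a => ?_
    have h := fun b => (continuous_apply b).comp ih
    by_cases ha : a = i n
    · simpa [freqIter, freqStep, ha, Function.comp_def] using! (h (i n)).sub (h (j n))
    · simpa [freqIter, freqStep, ha, Function.comp_def] using h a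

omit [DecidableEq A] in
theorem isClosed_setOf_brunOrdered (i j : A) : IsClosed {f : A → ℝ | BrunOrdered i j f} := by
  have : {f : A → ℝ | BrunOrdered i j f} =
      {f | ∀ a, 0 ≤ f a} ∩ {f | f j ≤ f i} ∩ {f | ∀ a, a ≠ i → f a ≤ f j} := by
    ext f
    exact ⟨fun h => ⟨⟨h.1, h.2⟩, h.3⟩, fun h => ⟨h.1.1, h.1.2, h.2⟩⟩
  rw [this]
  refine (IsClosed.inter ?_ ?_).inter ?_
  · simp only [Set.ofPred_forall]
    exact isClosed_iInter fun a => isClosed_le continuous_const (continuous_apply a)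
  · exact isClosed_le (continuous_apply j) (continuous_apply i)
  · simp only [Set.ofPred_forall]
    exact isClosed_iInter fun a => isClosed_iInter fun _ =>
      isClosed_le (continuous_apply a) (continuous_apply j)

/-- Vectors that follow the Brun order along any finite stretch of an admissible sequence. -/
theorem exists_brunOrdered {i j : ℕ → A} (hij : ∀ n, i n ≠ j n)
    (hadm : ∀ n, (i (n + 1) = i n ∧ j (n + 1) = j n) ∨ i (n + 1) = j n) (N : ℕ) :
    ∃ f : A → ℝ, f ≠ 0 ∧ ∀ n ≤ N, BrunOrdered (i n) (j n) (freqIter i j f n) := by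
  induction N generalizing i j with
  | zero =>
    refine ⟨fun _ => 1, fun h => one_ne_zero (congrFun h (i 0)), fun n hn => ?_⟩
    obtain rfl : n = 0 := by omega
    exact ⟨fun _ => zero_le_one, le_rfl, fun _ _ => le_rfl⟩
  | succ N ih =>
    obtain ⟨g, hg0, hg⟩ := ih (i := fun t => i (1 + t)) (j := fun t => j (1 + t))
      (fun n => hij _) (fun n => hadm _)
    have h0 := hg 0 (Nat.zero_le _)
    simp only [freqIter, add_zero] at h0
    -- One step of the algorithm is undone. Admissibility makes `g (j 0)` dominate all entries other
    -- than that of `i 0`, so `f` has the required order.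
    set f : A → ℝ := fun a => if a = i 0 then g (i 0) + g (j 0) else g a with hf
    have hstep : freqIter i j f 1 = g := by
      funext a
      by_cases ha : a = i 0 <;> simp [freqIter, freqStep, hf, ha, (hij 0).symm]
    have hfi : f (i 0) = g (i 0) + g (j 0) := by simp [hf]
    have hfa : ∀ a, a ≠ i 0 → f a = g a := fun a ha => by simp [hf, ha]
    refine ⟨f, fun h => hg0 ?_, fun n hn => ?_⟩
    · rw [← hstep, h]
      funext a
      simp [freqIter, freqStep]
    · rcases n with _ | n
      · have hle : ∀ a, a ≠ i 0 → g a ≤ g (j 0) := by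
          intro a ha
          rcases hadm 0 with h | h
          · have := h0.le_snd a
            simp only [zero_add] at h
            rw [h.1, h.2] at this
            exact this ha
          · have := h0.le_fst a
            simp only [zero_add] at h
            rwa [h] at this
        refine ⟨fun a => ?_, ?_, fun a ha => ?_⟩ <;> simp only [freqIter]
        · by_cases ha : a = i 0
          · rw [ha, hfi]
            exact add_nonneg (h0.nonneg _) (h0.nonneg _)
          · rw [hfa a ha]
            exact h0.nonneg a
        · rw [hfi, hfa _ (hij 0).symm]
          linarith [h0.nonneg (i 0)]
        · rw [hfa a ha, hfa _ (hij 0).symm]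
          exact hle a ha
      · rw [Nat.add_comm n 1, freqIter_add, hstep]
        exact hg n (by omega)

end Dynamics

/-! ### Contraction of the sup norm on the orthogonal complement, for three letters. -/

section ThreeLetters

theorem exists_third {i j : Fin 3} (hij : i ≠ j) :
    ∃ k, k ≠ i ∧ k ≠ j ∧ (∀ a, a = i ∨ a = j ∨ a = k) ∧
      ∀ g : Fin 3 → ℝ, ∑ a, g a = g i + g j + g k := by
  have h : ∃ k, k ≠ i ∧ k ≠ j ∧ ∀ a, a = i ∨ a = j ∨ a = k := by
    revert i j
    decide
  obtain ⟨k, hki, hkj, hk⟩ := h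
  refine ⟨k, hki, hkj, hk, fun g => ?_⟩
  have hu : (Finset.univ : Finset (Fin 3)) = {i, j, k} := by
    ext a
    simpa using hk a
  rw [hu, Finset.sum_insert (by simp [hij, hki.symm]), Finset.sum_insert (by simp [hkj.symm]),
    Finset.sum_singleton, add_assoc]

theorem sum_dualStep_mul_freqStep {i j : Fin 3} (hij : i ≠ j) (x f : Fin 3 → ℝ) :
    ∑ a, dualStep i j x a * freqStep i j f a = ∑ a, x a * f a := by
  obtain ⟨k, hki, hkj, -, hsum⟩ := exists_third hij
  rw [hsum, hsum]
  simp only [dualStep, freqStep, hij, hij.symm, hki, hkj, if_true, if_false]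
  ring

theorem sum_dualIter_mul_freqIter {i j : ℕ → Fin 3} (hij : ∀ n, i n ≠ j n) (x f : Fin 3 → ℝ)
    (n : ℕ) : ∑ a, dualIter i j x n a * freqIter i j f n a = ∑ a, x a * f a := by
  induction n with
  | zero => rfl
  | succ n ih => rw [← ih]; exact sum_dualStep_mul_freqStep (hij n) _ _

/-- Only the entry `x i + x j` is new. If it exceeded `b`, then `x i > 0`, and with `k` the third
letter orthogonality would give `0 ≥ (x i + x j) * f j + x k * f k > b * (f j - f k) ≥ 0` when `f j
> 0`. The lower bound is symmetric; if `f j = 0`, then `f k = 0` and `x i = 0`. -/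
theorem abs_dualStep_le {i j : Fin 3} (hij : i ≠ j) {x f : Fin 3 → ℝ} (hf : BrunOrdered i j f)
    (h0 : f ≠ 0) (hxf : ∑ a, x a * f a = 0) {b : ℝ} (hb : ∀ a, |x a| ≤ b) (a : Fin 3) :
    |dualStep i j x a| ≤ b := by
  obtain ⟨k, hki, hkj, -, hsum⟩ := exists_third hij
  rw [hsum] at hxf
  by_cases ha : a = j
  · simp only [dualStep, ha, if_true]
    have hi := hf.fst_pos h0
    have h1 := abs_le.1 (hb i)
    have h2 := abs_le.1 (hb j)
    have h3 := abs_le.1 (hb k)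
    have hjn := hf.nonneg j
    have hij' := hf.snd_le_fst
    have hkj' := hf.le_snd k hki
    have hkn := hf.nonneg k
    have hbn : 0 ≤ b := (abs_nonneg _).trans (hb i)
    rw [abs_le]
    rcases hjn.eq_or_lt with hj0 | hj0
    · have hk0 : f k = 0 := le_antisymm (by linarith) hkn
      rw [← hj0, hk0] at hxf
      have : x i = 0 := by
        have : x i * f i = 0 := by linarith
        exact (mul_eq_zero.1 this).resolve_right hi.ne'
      rw [this]
      constructor <;> linarith
    · constructor
      · by_contra! hlt
        have hxi : x i < 0 := by linarith
        have e1 : x i * f i ≤ x i * f j := mul_le_mul_of_nonpos_left hij' hxi.le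
        have e2 : (x i + x j) * f j < -b * f j := mul_lt_mul_of_pos_right hlt hj0
        have e3 : x k * f k ≤ b * f k := mul_le_mul_of_nonneg_right h3.2 hkn
        have e4 : b * f k ≤ b * f j := mul_le_mul_of_nonneg_left hkj' hbn
        linarith
      · by_contra! hlt
        have hxi : 0 < x i := by linarith
        have e1 : x i * f j ≤ x i * f i := mul_le_mul_of_nonneg_left hij' hxi.le
        have e2 : b * f j < (x i + x j) * f j := mul_lt_mul_of_pos_right hlt hj0
        have e3 : -b * f k ≤ x k * f k := mul_le_mul_of_nonneg_right h3.1 hkn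
        have e4 : b * f k ≤ b * f j := mul_le_mul_of_nonneg_left hkj' hbn
        linarith
  · simpa [dualStep, ha] using hb a

theorem abs_dualIter_le {i j : ℕ → Fin 3} (hij : ∀ n, i n ≠ j n) {x f : Fin 3 → ℝ} {N : ℕ}
    (hf : ∀ n < N, BrunOrdered (i n) (j n) (freqIter i j f n))
    (h0 : f ≠ 0) (hxf : ∑ a, x a * f a = 0) {b : ℝ} (hb : ∀ a, |x a| ≤ b) (a : Fin 3) :
    |dualIter i j x N a| ≤ b := by
  induction N generalizing a with
  | zero => exact hb a
  | succ N ih =>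
    exact abs_dualStep_le (hij N) (hf N (by omega)) (freqIter_ne_zero hij h0 N)
      ((sum_dualIter_mul_freqIter hij x f N).trans hxf) (ih fun n hn => hf n (by omega)) a

/-- The equality case of `abs_dualStep_le` with `b = 1`: all inequalities become equalities, whence
`xi = 0` and a tie between the two smaller entries. -/
theorem eq_third_of_one_le_add {xi xj xk fi fj fk : ℝ} (hij : fj < fi) (hk : fk ≤ fj)
    (hk0 : 0 < fk) (hsum : xi * fi + xj * fj + xk * fk = 0) (hi : xi ≤ 1) (hj : xj ≤ 1)
    (hk1 : -1 ≤ xk) (h : 1 ≤ xi + xj) : 1 ≤ xj ∧ fk = fj := by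
  have hxi : 0 ≤ xi := by linarith
  have e1 : fj ≤ (xi + xj) * fj := le_mul_of_one_le_left (by linarith) h
  have e2 : -fk ≤ xk * fk := by nlinarith
  have e3 : xi * (fi - fj) ≤ 0 := by linarith
  have hxi0 : xi = 0 := by
    by_contra hne
    have : 0 < xi * (fi - fj) := mul_pos (lt_of_le_of_ne hxi (Ne.symm hne)) (by linarith)
    linarith
  subst hxi0
  exact ⟨by linarith, by linarith⟩

theorem one_le_abs_of_dualStep {i j : Fin 3} (hij : i ≠ j) {x f : Fin 3 → ℝ}
    (hf : BrunOrdered i j f) (hpos : ∀ a, 0 < f a) (hlt : f j < f i)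
    (hxf : ∑ a, x a * f a = 0) (hb : ∀ a, |x a| ≤ 1) {a : Fin 3} (ha : 1 ≤ |dualStep i j x a|) :
    1 ≤ |x a| ∧ (a = j → ∃ k, k ≠ i ∧ k ≠ j ∧ f k = f j) := by
  obtain ⟨k, hki, hkj, -, hsum⟩ := exists_third hij
  rw [hsum] at hxf
  by_cases haj : a = j
  · subst haj
    simp only [dualStep, if_true] at ha
    have h1 := abs_le.1 (hb i)
    have h2 := abs_le.1 (hb a)
    have h3 := abs_le.1 (hb k)
    rcases le_abs.1 ha with h | h
    · have := eq_third_of_one_le_add hlt (hf.le_snd k hki) (hpos k) hxf h1.2 h2.2 h3.1 h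
      exact ⟨this.1.trans (le_abs_self _), fun _ => ⟨k, hki, hkj, this.2⟩⟩
    · have := eq_third_of_one_le_add (xi := -x i) (xj := -x a) (xk := -x k) hlt
        (hf.le_snd k hki) (hpos k) (by linarith) (by linarith) (by linarith) (by linarith)
        (by linarith)
      exact ⟨this.1.trans (neg_le_abs _), fun _ => ⟨k, hki, hkj, this.2⟩⟩
  · exact ⟨by simpa [dualStep, haj] using ha, fun h => absurd h haj⟩

/-- An entry changes only while its letter is the leading one, and a leading entry is positive; so a
letter that leads later is positive now. -/
theorem freqIter_pos {i j : ℕ → Fin 3} (hij : ∀ n, i n ≠ j n) {f : Fin 3 → ℝ} {N : ℕ}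
    (hf : ∀ n ≤ N, BrunOrdered (i n) (j n) (freqIter i j f n)) (h0 : f ≠ 0) {m n : ℕ}
    (hmn : m ≤ n) (hn : n ≤ N) : 0 < freqIter i j f m (i n) := by
  have key : ∀ d m, m + d ≤ N → 0 < freqIter i j f m (i (m + d)) := by
    intro d
    induction d with
    | zero => exact fun m hm => (hf m hm).fst_pos (freqIter_ne_zero hij h0 m)
    | succ d ih =>
      intro m hm
      have h := ih (m + 1) (by omega)
      rw [show m + 1 + d = m + (d + 1) by omega] at h
      by_cases hi : i (m + (d + 1)) = i m
      · rw [hi]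
        exact (hf m (by omega)).fst_pos (freqIter_ne_zero hij h0 m)
      · simpa [freqIter, freqStep, hi] using h
  obtain ⟨d, rfl⟩ := Nat.exists_eq_add_of_le hmn
  exact key d m hn

/-- One window shows a letter other than `a`, the window starting there shows `a`; in between `a`
must take the lead, which admissibility allows only from second place. -/
theorem exists_switch {i j : ℕ → Fin 3} {h : ℕ}
    (hadm : ∀ n, (i (n + 1) = i n ∧ j (n + 1) = j n) ∨ i (n + 1) = j n)
    (hwin : ∀ n, i '' Set.Ico n (n + h) = Set.univ) (a : Fin 3) :
    ∃ m < 2 * h, j m = a ∧ i (m + 1) = a := by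
  have hex : ∀ n b, ∃ t, n ≤ t ∧ t < n + h ∧ i t = b := fun n b => by
    have : b ∈ i '' Set.Ico n (n + h) := hwin n ▸ Set.mem_univ b
    obtain ⟨t, ht, hb⟩ := this
    exact ⟨t, ht.1, ht.2, hb⟩
  obtain ⟨n, -, hn, hna⟩ := hex 0 (a + 1)
  obtain ⟨t, hnt, ht, hta⟩ := hex n a
  have hne : i n ≠ a := by
    rw [hna]
    clear hna hta ht hnt hn t n hex
    revert a
    decide
  by_contra! hcon
  have : ∀ d, n + d ≤ t → i (n + d) ≠ a := by
    intro d
    induction d with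
    | zero => exact fun _ => hne
    | succ d ih =>
      intro hd he
      rw [← add_assoc] at he
      rcases hadm (n + d) with h' | h'
      · exact ih (by omega) (h'.1 ▸ he)
      · exact hcon (n + d) (by omega) (h' ▸ he) he
  exact this (t - n) (by omega) (by rwa [Nat.add_sub_cancel' hnt])

/-- An entry of modulus 1 can be traced back at a fixed letter `c`. When `c` passes from second
place to the lead, the equality case ties `c` with the third letter; the tie survives the step and
contradicts the strict lead of `c`. The last `h` steps of the horizon serve to make `f` positive at
all times up to `2 * h + 2`. -/
theorem abs_dualIter_lt_one {i j : ℕ → Fin 3} {h : ℕ} (hij : ∀ n, i n ≠ j n)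
    (hadm : ∀ n, (i (n + 1) = i n ∧ j (n + 1) = j n) ∨ i (n + 1) = j n)
    (hwin : ∀ n, i '' Set.Ico n (n + h) = Set.univ) {x f : Fin 3 → ℝ}
    (hf : ∀ n ≤ 3 * h + 2, BrunOrdered (i n) (j n) (freqIter i j f n))
    (h0 : f ≠ 0) (hxf : ∑ a, x a * f a = 0) (hb : ∀ a, |x a| ≤ 1) (a : Fin 3) :
    |dualIter i j x (3 * h + 2) a| < 1 := by
  have horth n : ∑ a, dualIter i j x n a * freqIter i j f n a = 0 :=
    (sum_dualIter_mul_freqIter hij x f n).trans hxf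
  have hle : ∀ n ≤ 3 * h + 2, ∀ b, |dualIter i j x n b| ≤ 1 := fun n hn =>
    abs_dualIter_le hij (fun m hm => hf m (by omega)) h0 hxf hb
  have hpos : ∀ n ≤ 2 * h + 2, ∀ b, 0 < freqIter i j f n b := fun n hn b => by
    have : b ∈ i '' Set.Ico n (n + h) := hwin n ▸ Set.mem_univ b
    obtain ⟨t, ht, rfl⟩ := this
    have := ht.2
    exact freqIter_pos hij hf h0 ht.1 (by omega)
  have hlt : ∀ n < 2 * h + 2, freqIter i j f n (j n) < freqIter i j f n (i n) := fun n hn => by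
    have := hpos (n + 1) hn (i n)
    simp only [freqIter, freqStep, if_true] at this
    linarith
  by_contra! hcon
  obtain ⟨c, hc⟩ : ∃ c, 1 ≤ |dualIter i j x (2 * h + 2) c| := by
    obtain ⟨c, hmax⟩ := Finite.exists_max fun b => |dualIter i j x (2 * h + 2) b|
    refine ⟨c, hcon.trans ?_⟩
    rw [show 3 * h + 2 = 2 * h + 2 + h by omega, dualIter_add]
    refine abs_dualIter_le (f := freqIter i j f (2 * h + 2)) (fun n => hij _) (fun n hn => ?_)
      (freqIter_ne_zero hij h0 _) (horth _) hmax a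
    rw [← freqIter_add]
    exact hf _ (by omega)
  have hone : ∀ d ≤ 2 * h + 2, 1 ≤ |dualIter i j x (2 * h + 2 - d) c| := by
    intro d
    induction d with
    | zero => exact fun _ => hc
    | succ d ih =>
      intro hd
      have := ih (by omega)
      obtain ⟨n, hn⟩ : ∃ n, n = 2 * h + 2 - (d + 1) := ⟨_, rfl⟩
      rw [← hn]
      rw [show 2 * h + 2 - d = n + 1 by omega] at this
      exact (one_le_abs_of_dualStep (hij n) (hf n (by omega)) (hpos n (by omega))
        (hlt n (by omega)) (horth n) (hle n (by omega)) this).1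
  obtain ⟨m, hm, hjm, him⟩ := exists_switch hadm hwin c
  have h1 := hone (2 * h + 2 - (m + 1)) (by omega)
  rw [show 2 * h + 2 - (2 * h + 2 - (m + 1)) = m + 1 by omega] at h1
  obtain ⟨k, hki, hkj, hk⟩ := (one_le_abs_of_dualStep (hij m) (hf m (by omega))
    (hpos m (by omega)) (hlt m (by omega)) (horth m) (hle m (by omega)) h1).2 hjm.symm
  have hne : c ≠ i m := hjm ▸ (hij m).symm
  have hfk : freqIter i j f (m + 1) k = freqIter i j f m k := by simp [freqIter, freqStep, hki]
  have hfc : freqIter i j f (m + 1) c = freqIter i j f m c := by simp [freqIter, freqStep, hne]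
  have h2 := (hf (m + 1) (by omega)).le_snd k (by rw [him, ← hjm]; exact hkj)
  have h3 := hlt (m + 1) (by omega)
  rw [him] at h3
  rw [hjm] at hk
  linarith

/-- By homogeneity `x` may be taken in the unit ball and `f` in the simplex. The admissible pairs
form a compact set, so the strict bound is attained as a maximum below 1. -/
theorem exists_contraction_of_directive {i j : ℕ → Fin 3} {h : ℕ} (hij : ∀ n, i n ≠ j n)
    (hadm : ∀ n, (i (n + 1) = i n ∧ j (n + 1) = j n) ∨ i (n + 1) = j n)
    (hwin : ∀ n, i '' Set.Ico n (n + h) = Set.univ) :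
    ∃ r : ℝ, 0 ≤ r ∧ r < 1 ∧ ∀ x f : Fin 3 → ℝ,
      (∀ n ≤ 3 * h + 2, BrunOrdered (i n) (j n) (freqIter i j f n)) → f ≠ 0 →
      ∑ a, x a * f a = 0 → ∀ b : ℝ, (∀ a, |x a| ≤ b) →
      ∀ a, |dualIter i j x (3 * h + 2) a| ≤ r * b := by
  have hlt := fun x f => abs_dualIter_lt_one hij hadm hwin (x := x) (f := f)
  generalize 3 * h + 2 = L at hlt ⊢
  let K : Set ((Fin 3 → ℝ) × (Fin 3 → ℝ)) :=
    (Metric.closedBall 0 1 ×ˢ stdSimplex ℝ (Fin 3)) ∩ ({p | ∑ a, p.1 a * p.2 a = 0} ∩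
      ⋂ n, ⋂ (_ : n ≤ L), (fun p => freqIter i j p.2 n) ⁻¹'
        {f | BrunOrdered (i n) (j n) f})
  have hK : IsCompact K := by
    refine ((isCompact_closedBall _ _).prod (isCompact_stdSimplex ℝ (Fin 3))).inter_right
      (IsClosed.inter (isClosed_eq (by fun_prop) continuous_const) ?_)
    exact isClosed_iInter fun n => isClosed_iInter fun _ =>
      (isClosed_setOf_brunOrdered _ _).preimage ((continuous_freqIter i j n).comp continuous_snd)
  have hmem : ∀ x f : Fin 3 → ℝ, (x, f) ∈ K ↔ (∀ a, |x a| ≤ 1) ∧ f ∈ stdSimplex ℝ (Fin 3) ∧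
      ∑ a, x a * f a = 0 ∧
      ∀ n ≤ L, BrunOrdered (i n) (j n) (freqIter i j f n) := fun x f => by
    simp [K, pi_norm_le_iff_of_nonneg, and_assoc]
  have hmem0 : ∀ f ∈ stdSimplex ℝ (Fin 3), f ≠ 0 := by
    rintro f hf rfl
    simpa using hf.2
  obtain ⟨r, hr0, hr1, hr⟩ : ∃ r : ℝ, 0 ≤ r ∧ r < 1 ∧
      ∀ p ∈ K, ‖dualIter i j p.1 (L)‖ ≤ r := by
    rcases K.eq_empty_or_nonempty with hne | hne
    · exact ⟨0, le_rfl, one_pos, by simp [hne]⟩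
    · obtain ⟨⟨x, f⟩, hp, hmax⟩ := hK.exists_isMaxOn hne
        ((continuous_dualIter i j _).comp continuous_fst).norm.continuousOn
      refine ⟨‖dualIter i j x L‖, norm_nonneg _, ?_, fun p hp => hmax hp⟩
      obtain ⟨hx, hf, hxf, hord⟩ := (hmem x f).1 hp
      exact (pi_norm_lt_iff one_pos).2
        (hlt x f hord (hmem0 f hf) hxf hx)
  refine ⟨r, hr0, hr1, fun x f hord h0 hxf b hb a => ?_⟩
  have hb0 : 0 ≤ b := (abs_nonneg _).trans (hb a)
  rcases hb0.eq_or_lt with rfl | hb0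
  · rw [mul_zero]
    exact abs_dualIter_le hij (fun n hn => hord n hn.le) h0 hxf hb a
  have hs : 0 < ∑ a, f a := Finset.sum_pos' (fun a _ => (hord 0 (Nat.zero_le _)).nonneg a)
    ⟨i 0, Finset.mem_univ _, (hord 0 (Nat.zero_le _)).fst_pos h0⟩
  have hmem' : (b⁻¹ • x, (∑ a, f a)⁻¹ • f) ∈ K := by
    refine (hmem _ _).2 ⟨fun a => ?_, ⟨fun a => ?_, ?_⟩, ?_, fun n hn => ?_⟩
    · rw [Pi.smul_apply, smul_eq_mul, abs_mul, abs_of_pos (inv_pos.2 hb0), inv_mul_le_iff₀ hb0,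
        mul_one]
      exact hb a
    · exact mul_nonneg (inv_nonneg.2 hs.le) ((hord 0 (Nat.zero_le _)).nonneg a)
    · simp only [Pi.smul_apply, smul_eq_mul, ← Finset.mul_sum]
      exact inv_mul_cancel₀ hs.ne'
    · calc ∑ c, (b⁻¹ • x) c * ((∑ a, f a)⁻¹ • f) c
          = b⁻¹ * (∑ a, f a)⁻¹ * ∑ c, x c * f c := by
            rw [Finset.mul_sum]
            exact Finset.sum_congr rfl fun c _ => mul_mul_mul_comm _ _ _ _
        _ = 0 := by rw [hxf, mul_zero]
    · rw [freqIter_smul]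
      exact (hord n hn).smul (inv_nonneg.2 hs.le)
  have := (norm_le_pi_norm _ a).trans (hr _ hmem')
  rwa [dualIter_smul, Pi.smul_apply, smul_eq_mul, Real.norm_eq_abs, abs_mul,
    abs_of_pos (inv_pos.2 hb0), inv_mul_le_iff₀ hb0, mul_comm] at this

theorem exists_contraction (h : ℕ) :
    ∃ r : ℝ, 0 ≤ r ∧ r < 1 ∧ ∀ i j : ℕ → Fin 3, (∀ n, i n ≠ j n) →
      (∀ n, (i (n + 1) = i n ∧ j (n + 1) = j n) ∨ i (n + 1) = j n) →
      (∀ n, i '' Set.Ico n (n + h) = Set.univ) → ∀ x f : Fin 3 → ℝ,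
      (∀ n ≤ 3 * h + 2, BrunOrdered (i n) (j n) (freqIter i j f n)) → f ≠ 0 →
      ∑ a, x a * f a = 0 → ∀ b : ℝ, (∀ a, |x a| ≤ b) →
      ∀ a, |dualIter i j x (3 * h + 2) a| ≤ r * b := by
  -- Only the indices at times `0, …, 3 * h + 2` matter, and they form finitely many patterns; for a
  -- pattern that never occurs, `r = 0` will do.
  have key : ∀ v : Fin (3 * h + 3) → Fin 3 × Fin 3,
      ∃ r : ℝ, 0 ≤ r ∧ r < 1 ∧ ∀ i j : ℕ → Fin 3, (∀ n, i n ≠ j n) →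
        (∀ n, (i (n + 1) = i n ∧ j (n + 1) = j n) ∨ i (n + 1) = j n) →
        (∀ n, i '' Set.Ico n (n + h) = Set.univ) → (∀ n : Fin (3 * h + 3), (i n, j n) = v n) →
        ∀ x f : Fin 3 → ℝ,
        (∀ n ≤ 3 * h + 2, BrunOrdered (i n) (j n) (freqIter i j f n)) → f ≠ 0 →
        ∑ a, x a * f a = 0 → ∀ b : ℝ, (∀ a, |x a| ≤ b) →
        ∀ a, |dualIter i j x (3 * h + 2) a| ≤ r * b := by
    intro v
    by_cases hv : ∃ i j : ℕ → Fin 3, (∀ n, i n ≠ j n) ∧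
        (∀ n, (i (n + 1) = i n ∧ j (n + 1) = j n) ∨ i (n + 1) = j n) ∧
        (∀ n, i '' Set.Ico n (n + h) = Set.univ) ∧ (∀ n : Fin (3 * h + 3), (i n, j n) = v n)
    · obtain ⟨i, j, hij, hadm, hwin, hv⟩ := hv
      obtain ⟨r, hr0, hr1, hr⟩ := exists_contraction_of_directive hij hadm hwin
      refine ⟨r, hr0, hr1, fun i' j' _ _ _ hv' x f hf h0 hxf b hb a => ?_⟩
      have heq : ∀ n < 3 * h + 3, i' n = i n ∧ j' n = j n := fun n hn =>
        Prod.ext_iff.1 ((hv' ⟨n, hn⟩).trans (hv ⟨n, hn⟩).symm)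
      rw [dualIter_congr x (fun t ht => (heq t (by omega)).1) fun t ht => (heq t (by omega)).2]
      refine hr x f (fun n hn => ?_) h0 hxf b hb a
      have := hf n hn
      rwa [freqIter_congr f (fun t ht => (heq t (by omega)).1) fun t ht => (heq t (by omega)).2,
        (heq n (by omega)).1, (heq n (by omega)).2] at this
    · refine ⟨0, le_rfl, one_pos, fun i j hij hadm hwin hv' => ?_⟩
      exact absurd ⟨i, j, hij, hadm, hwin, hv'⟩ hv
  choose r hr0 hr1 hr using key
  obtain ⟨v₀, hmax⟩ := Finite.exists_max r
  refine ⟨r v₀, hr0 v₀, hr1 v₀, fun i j hij hadm hwin x f hf h0 hxf b hb a => ?_⟩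
  refine (hr (fun n => (i n, j n)) i j hij hadm hwin (fun _ => rfl) x f hf h0 hxf b hb a).trans ?_
  exact mul_le_mul_of_nonneg_right (hmax _) ((abs_nonneg _).trans (hb a))

end ThreeLetters

/-! ### Weights of words and desubstitution of prefixes. -/

section Words

variable {A : Type*} [DecidableEq A]

omit [DecidableEq A] in
theorem factor_zero_succ (ω : ℕ → A) (n : ℕ) : factor ω 0 (n + 1) = factor ω 0 n ++ [ω n] := by
  simp [factor, List.range'_1_concat]

omit [DecidableEq A] in
theorem factor_append (ω : ℕ → A) {k l : ℕ} (hkl : k ≤ l) :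
    factor ω 0 k ++ factor ω k l = factor ω 0 l := by
  obtain ⟨d, rfl⟩ := Nat.exists_eq_add_of_le hkl
  simp only [factor, Nat.sub_zero, Nat.add_sub_cancel_left, ← List.map_append]
  congr 1
  simpa using List.range'_append_1 (s := 0) (m := k) (n := d)

/-- The sum of the weights `x` of the letters of a finite word. -/
def weight (x : A → ℝ) (u : List A) : ℝ := (u.map x).sum

omit [DecidableEq A] in
theorem weight_append (x : A → ℝ) (u v : List A) : weight x (u ++ v) = weight x u + weight x v := by
  simp [weight]

theorem weight_brun (i j : A) (x : A → ℝ) (u : List A) :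
    weight x ((brun i j).apply u) = weight (dualStep i j x) u := by
  induction u with
  | nil => rfl
  | cons a u ih =>
    have : (brun i j).apply (a :: u) = brun i j a ++ (brun i j).apply u := rfl
    rw [this, weight_append, ih]
    by_cases h : a = j <;> simp [weight, brun, dualStep, h]

omit [DecidableEq A] in
theorem abs_weight_le {x : A → ℝ} {b : ℝ} (hb : ∀ a, |x a| ≤ b) (u : List A) :
    |weight x u| ≤ b * u.length := by
  induction u with
  | nil => simp [weight]
  | cons a u ih =>
    have : weight x (a :: u) = x a + weight x u := by simp [weight]
    rw [this, List.length_cons, Nat.cast_succ]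
    have h1 := abs_add_le (x a) (weight x u)
    have h2 := hb a
    linarith

theorem weight_sub_mul (s c : ℝ) (a : A) (u : List A) :
    weight (fun b => (if b = a then s else 0) - c) u = s * u.count a - c * u.length := by
  induction u with
  | nil => simp [weight]
  | cons b u ih =>
    have : ∀ x : A → ℝ, weight x (b :: u) = x b + weight x u := fun x => by simp [weight]
    rw [this, ih]
    by_cases h : b = a
    · subst h
      simp
      ring
    · simp [h]
      ring

/-- A prefix of the image under `β_{ij}` is the image of a prefix, up to a last letter `i`. -/
theorem exists_prefix_of_mapsTo_brun {i j : A} {w u : ℕ → A} (hwu : (brun i j).MapsTo w u)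
    (m : ℕ) : ∃ m' ≤ m, factor u 0 m = (brun i j).apply (factor w 0 m') ∨
      factor u 0 m = (brun i j).apply (factor w 0 m') ++ [i] := by
  -- Recording `w m' = j` ensures that a dangling `i` is completed to the block `ij` by the next
  -- letter.
  suffices H : ∃ m' ≤ m, factor u 0 m = (brun i j).apply (factor w 0 m') ∨
      (m' + 1 ≤ m ∧ w m' = j ∧ factor u 0 m = (brun i j).apply (factor w 0 m') ++ [i]) by
    obtain ⟨m', hm, h | h⟩ := H
    exacts [⟨m', hm, .inl h⟩, ⟨m', hm, .inr h.2.2⟩]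
  have hlen : ∀ t, (factor u 0 t).length = t := fun t => by simp [factor]
  have happ : ∀ m', (brun i j).apply (factor w 0 (m' + 1)) =
      (brun i j).apply (factor w 0 m') ++ brun i j (w m') := fun m' => by
    simp [factor_zero_succ, Substitution.apply]
  induction m with
  | zero => exact ⟨0, le_rfl, .inl rfl⟩
  | succ m ih =>
    obtain ⟨m', hm, h | ⟨hm', hj, h⟩⟩ := ih
    · have hp := hwu.1 (m' + 1)
      rw [happ, ← h, List.length_append, hlen] at hp
      by_cases hj : w m' = j
      · refine ⟨m', by omega, .inr ⟨by omega, hj, ?_⟩⟩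
        simp only [brun, hj, if_true, List.length_cons, List.length_nil] at hp
        rw [show m + (0 + 1 + 1) = m + 1 + 1 from rfl, factor_zero_succ, factor_zero_succ,
          List.append_assoc, List.append_cancel_left_eq] at hp
        rw [factor_zero_succ, h]
        simp at hp
        rw [hp.1]
      · refine ⟨m' + 1, by omega, .inl ?_⟩
        rw [happ, ← h, hp]
        simp [brun, hj]
    · have hp := hwu.1 (m' + 1)
      rw [happ] at hp
      simp only [brun, hj, if_true] at hp
      have e : (brun i j).apply (factor w 0 m') ++ [i, j] = factor u 0 m ++ [j] := by simp [h]
      rw [e, List.length_append, hlen] at hp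
      refine ⟨m' + 1, by omega, .inl ?_⟩
      rw [happ, hj]
      simp only [brun, if_true]
      rw [e]
      exact hp.symm

end Words

/-! ### Prefix discrepancies and balance. -/

theorem abs_weight_prefix_le {i j : ℕ → Fin 3} (hij : ∀ n, i n ≠ j n) {W : ℕ → ℕ → Fin 3}
    (hW : ∀ n, (brun (i n) (j n)).MapsTo (W (n + 1)) (W n)) {x f : Fin 3 → ℝ} {N : ℕ}
    (hf : ∀ n < N, BrunOrdered (i n) (j n) (freqIter i j f n)) (h0 : f ≠ 0)
    (hxf : ∑ a, x a * f a = 0) {b : ℝ} (hb : ∀ a, |x a| ≤ b) (m : ℕ) :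
    ∃ m' ≤ m, |weight x (factor (W 0) 0 m)| ≤
      |weight (dualIter i j x N) (factor (W N) 0 m')| + N * b := by
  induction N with
  | zero => exact ⟨m, le_rfl, by simp [dualIter]⟩
  | succ N ih =>
    obtain ⟨m₁, hm₁, h₁⟩ := ih fun n hn => hf n (by omega)
    obtain ⟨m₂, hm₂, h₂⟩ := exists_prefix_of_mapsTo_brun (hW N) m₁
    refine ⟨m₂, hm₂.trans hm₁, h₁.trans ?_⟩
    have hx := abs_dualIter_le hij (fun n hn => hf n (Nat.lt_succ_of_lt hn)) h0 hxf hb (i N)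
    have hb0 := (abs_nonneg _).trans hx
    push_cast
    rcases h₂ with h₂ | h₂
    · rw [h₂, weight_brun]
      simp only [dualIter]
      linarith
    · rw [h₂, weight_append, weight_brun]
      have h3 := abs_add_le
        (weight (dualStep (i N) (j N) (dualIter i j x N)) (factor (W (N + 1)) 0 m₂))
        (weight (dualIter i j x N) [i N])
      have h4 : weight (dualIter i j x N) [i N] = dualIter i j x N (i N) := by simp [weight]
      rw [h4] at h3 ⊢
      simp only [dualIter]
      linarith

/-- Each block of `3 * h + 2` desubstitutions costs one letter per step and multiplies the bound on
the weights by `r`. The term `r ^ q * m` is the trivial bound on what remains after `q` blocks. -/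
theorem abs_weight_prefix_le_geometric {h : ℕ} {r : ℝ} (hr0 : 0 ≤ r) (hr1 : r < 1)
    (hr : ∀ i j : ℕ → Fin 3, (∀ n, i n ≠ j n) →
      (∀ n, (i (n + 1) = i n ∧ j (n + 1) = j n) ∨ i (n + 1) = j n) →
      (∀ n, i '' Set.Ico n (n + h) = Set.univ) → ∀ x f : Fin 3 → ℝ,
      (∀ n ≤ 3 * h + 2, BrunOrdered (i n) (j n) (freqIter i j f n)) → f ≠ 0 →
      ∑ a, x a * f a = 0 → ∀ b : ℝ, (∀ a, |x a| ≤ b) →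
      ∀ a, |dualIter i j x (3 * h + 2) a| ≤ r * b)
    (q : ℕ) {i j : ℕ → Fin 3} (hij : ∀ n, i n ≠ j n)
    (hadm : ∀ n, (i (n + 1) = i n ∧ j (n + 1) = j n) ∨ i (n + 1) = j n)
    (hwin : ∀ n, i '' Set.Ico n (n + h) = Set.univ) {W : ℕ → ℕ → Fin 3}
    (hW : ∀ n, (brun (i n) (j n)).MapsTo (W (n + 1)) (W n)) {x f : Fin 3 → ℝ}
    (hf : ∀ n ≤ q * (3 * h + 2), BrunOrdered (i n) (j n) (freqIter i j f n)) (h0 : f ≠ 0)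
    (hxf : ∑ a, x a * f a = 0) {b : ℝ} (hb : ∀ a, |x a| ≤ b) (m : ℕ) :
    |weight x (factor (W 0) 0 m)| ≤ ((3 * h + 2 : ℕ) / (1 - r) + r ^ q * m) * b := by
  have h1r : 0 < 1 - r := by linarith
  have hb0 : 0 ≤ b := (abs_nonneg _).trans (hb 0)
  induction q generalizing i j W x f b m with
  | zero =>
    refine (abs_weight_le hb _).trans ?_
    rw [mul_comm]
    refine mul_le_mul_of_nonneg_right ?_ hb0
    have : (0 : ℝ) ≤ (3 * h + 2 : ℕ) / (1 - r) := by positivity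
    simpa [factor] using this
  | succ q ih =>
    obtain ⟨L, hL⟩ : ∃ L, L = 3 * h + 2 := ⟨_, rfl⟩
    rw [← hL] at hr ih hf ⊢
    have hmul : (q + 1) * L = L + q * L := by ring
    rw [hmul] at hf
    have hf' : ∀ n ≤ L, BrunOrdered (i n) (j n) (freqIter i j f n) :=
      fun n hn => hf n (hn.trans (Nat.le_add_right _ _))
    obtain ⟨m', hm', hle⟩ := abs_weight_prefix_le hij hW (fun n hn => hf' n hn.le) h0 hxf hb m
    have hwin' : ∀ n, (fun t => i (L + t)) '' Set.Ico n (n + h) = Set.univ := fun n => by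
      rw [← hwin (L + n), ← Set.image_image i (fun t => L + t), Set.image_const_add_Ico, add_assoc]
    have := ih (i := fun t => i (L + t)) (j := fun t => j (L + t)) (W := fun t => W (L + t))
      (fun n => hij _) (fun n => hadm _) hwin' (fun n => hW _)
      (f := freqIter i j f L)
      (fun n hn => by rw [← freqIter_add]; exact hf _ (by omega)) (freqIter_ne_zero hij h0 L)
      ((sum_dualIter_mul_freqIter hij x f L).trans hxf)
      (hr i j hij hadm hwin x f hf' h0 hxf b hb) m' (mul_nonneg hr0 hb0)
    simp only [add_zero] at this
    have hm'' : r ^ (q + 1) * m' ≤ r ^ (q + 1) * m :=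
      mul_le_mul_of_nonneg_left (Nat.cast_le.2 hm') (pow_nonneg hr0 _)
    calc |weight x (factor (W 0) 0 m)|
        ≤ (L / (1 - r) + r ^ q * m') * (r * b) + L * b := hle.trans (by linarith)
      -- `L / (1 - r)` is the fixed point of `c ↦ r * c + L`.
      _ = (L / (1 - r) + r ^ (q + 1) * m') * b := by
        field_simp
        ring
      _ ≤ _ := mul_le_mul_of_nonneg_right (by linarith) hb0

end BrunWords

open BrunWords in
theorem theoremt (h : ℕ) :
    ∃ C : ℕ, ∀ i j ω : ℕ → Fin 3, BrunWords.IsBrunWord i j ω →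
      (∀ n : ℕ, i '' Set.Ico n (n + h) = Set.univ) →
      BrunWords.Balanced C ω := by
  obtain ⟨r, hr0, hr1, hr⟩ := exists_contraction h
  obtain ⟨D, hD⟩ : ∃ D : ℝ, D = (3 * h + 2 : ℕ) / (1 - r) + 1 := ⟨_, rfl⟩
  -- Each of the two factors is a difference of two prefixes, and each prefix contributes `D`; the
  -- `+ 1` in `D` absorbs the remainder `r ^ q * m`.
  refine ⟨⌈4 * D⌉₊, fun i j ω hω hwin u v hu hv huv a => ?_⟩
  obtain ⟨⟨hij, hadm, -⟩, W, rfl, hW⟩ := hω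
  obtain ⟨k, l, hkl, rfl⟩ := hu
  obtain ⟨k', l', hkl', rfl⟩ := hv
  obtain ⟨q, hq⟩ : ∃ q : ℕ, r ^ q * (l + l' : ℕ) ≤ 1 := by
    have : Filter.Tendsto (fun q : ℕ => r ^ q * ((l + l' : ℕ) : ℝ)) Filter.atTop (nhds 0) := by
      simpa using (tendsto_pow_atTop_nhds_zero_of_lt_one hr0 hr1).mul_const ((l + l' : ℕ) : ℝ)
    exact ((this.eventually_lt_const one_pos).mono fun _ => le_of_lt).exists
  obtain ⟨f, h0, hf⟩ := exists_brunOrdered hij hadm (q * (3 * h + 2))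
  have hord := hf 0 (Nat.zero_le _)
  obtain ⟨s, hs⟩ : ∃ s, s = ∑ b, f b := ⟨_, rfl⟩
  have hs0 : 0 < s := hs ▸ Finset.sum_pos' (fun b _ => hord.nonneg b)
    ⟨i 0, Finset.mem_univ _, hord.fst_pos h0⟩
  have hfa : f a ≤ s := hs ▸ Finset.single_le_sum (fun b _ => hord.nonneg b) (Finset.mem_univ a)
  have hfa0 : 0 ≤ f a := hord.nonneg a
  -- The weight of a word is then `s` times its count of `a` minus `f a` times its length; the
  -- length terms cancel between `u` and `v`.
  obtain ⟨x, hx⟩ : ∃ x : Fin 3 → ℝ, x = fun b => (if b = a then s else 0) - f a := ⟨_, rfl⟩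
  have hxf : ∑ b, x b * f b = 0 := by
    simp only [hx, sub_mul, Finset.sum_sub_distrib, ← Finset.mul_sum, ← hs, ite_mul, zero_mul,
      Finset.sum_ite_eq', Finset.mem_univ, if_true]
    ring
  have hxs : ∀ b, |x b| ≤ s := fun b => by
    rw [hx, abs_le]
    by_cases hb : b = a <;> simp only [hb, if_true, if_false] <;> constructor <;> linarith
  have hpre : ∀ m ≤ l + l', |weight x (factor (W 0) 0 m)| ≤ D * s := fun m hm => by
    refine (abs_weight_prefix_le_geometric hr0 hr1 hr q hij hadm hwin hW hf h0 hxf hxs m).trans ?_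
    refine mul_le_mul_of_nonneg_right ?_ hs0.le
    have : r ^ q * m ≤ r ^ q * (l + l' : ℕ) :=
      mul_le_mul_of_nonneg_left (Nat.cast_le.2 hm) (pow_nonneg hr0 _)
    rw [hD]
    linarith
  have hfac : ∀ k l, k ≤ l → weight x (factor (W 0) k l) =
      weight x (factor (W 0) 0 l) - weight x (factor (W 0) 0 k) := fun k l hkl => by
    rw [← factor_append (W 0) hkl, weight_append]
    ring
  have hu := hfac k l hkl
  have hv := hfac k' l' hkl'
  have e1 := abs_le.1 (hpre k (by omega))
  have e2 := abs_le.1 (hpre l (by omega))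
  have e3 := abs_le.1 (hpre k' (by omega))
  have e4 := abs_le.1 (hpre l' (by omega))
  rw [hx, weight_sub_mul, ← hx] at hu hv
  rw [← huv] at hv
  have hC := Nat.le_ceil (4 * D)
  have hmain : |((factor (W 0) k l).count a : ℝ) - (factor (W 0) k' l').count a| ≤ 4 * D := by
    rw [← mul_le_mul_iff_of_pos_left hs0, ← abs_of_pos hs0, ← abs_mul, abs_of_pos hs0, abs_le]
    constructor <;> linarith
  have := abs_le.1 (hmain.trans hC)
  constructor
  · exact_mod_cast this.1
  · exact_mod_cast this.2
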